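/- Let $T$ be a complete first-order theory in a language $\mathcal L$, let $\mu$ be a cardinal, and let $\mathcal M\models T$ be $\mu$-saturated (for example, a large saturated model of cardinality $\mu$). Formulas may have parameters in $\mathcal M$, and all tuples, sequences and sets are taken in $\mathcal M$. A set of formulas is consistent if each of its finite subsets is satisfied in $\mathcal M$; a set of formulas implies a formula if some finite subset of it does so in $\mathcal M$; $a\equiv_A b$ means $\mathrm{tp}(a/A)=\mathrm{tp}(b/A)$, and $\equiv$ means $\equiv_\emptyset$. We use the following notions. - An $\mathcal L$-formula $\varphi(x,y)$ ($x,y$ finite tuples of variables) has TP$_2$ if there are tuples $a^i_j$ ($i,j<\omega$) such that $\{\varphi(x,a^i_j),\varphi(x,a^i_k)\}$ is inconsistent for all $i$ and all $j\neq k$, whereas $\{\varphi(x,a^i_{f(i)})\mid i<\omega\}$ is consistent for every $f:\omega\to\omega$. - A formula $\psi(x,b)$ divides over $A$ if there is an $A$-indiscernible sequence $\langle b_i\mid i<\omega\rangle$ with $b_0=b$ such that $\{\psi(x,b_i)\mid i<\omega\}$ is inconsistent. A formula forks over $A$ if it implies a finite disjunction of formulas, each of which divides over $A$. Write $a\perp_A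 B$ if $\mathrm{tp}(a/AB)$ does not imply a formula that forks over $A$. - A Morley sequence over $A$ is an $A$-indiscernible sequence $\langle b_i\mid i<\omega\rangle$ with $b_i\perp_A b_{<i}$ for all $i<\omega$. - A formula $\psi(x,b)$ Kim-divides over $A$, witnessed by $J=\langle b_i\mid i<\omega\rangle$, if $J$ is a Morley sequence over $A$ with $b_0=b$ and $\{\psi(x,b_i)\mid i<\omega\}$ is inconsistent. A formula Kim-forks over $A$ if it implies a finite disjunction of formulas, each of which Kim-divides over $A$. Write $a\perp^K_A B$ if $\mathrm{tp}(a/AB)$ does not imply a formula that Kim-forks over $A$. **Proposition.** Assume that the $\mathcal L$-formula $\varphi(x,y)$ has TP$_2$. Then for each infinite cardinal $\kappa<\mu$ there are a set $A$ with $|A|\le\kappa$, a finite tuple $d$, pairwise distinct finite tuples $c_i$ ($i<\kappa$), and sequences $J_i$ ($i<\kappa$), such that for all $i,k<\kappa$: 1. $d\models\varphi(x,c_i)$; 2. $\varphi(x,c_i)$ Kim-divides over $A$, witnessed by the Morley sequence $J_i$ over $A$, which starts with $c_i$ (so $d\not\perp^K_A c_i$); moreover $J_i\equiv J_k$ (so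 $c_i\equiv c_k$); 3. $c_i\perp_A\{c_l\mid l<\kappa,\ l\ne i\}$ (so $c_i\perp^K_A\{c_l\mid l<\kappa,\ l\neq i\}$). -/

import Mathlib

open FirstOrder Cardinal

universe u v w

namespace KimForking

/-- A formula `ψ(x, b)` in the variables `x = (x_0, …, x_{n-1})` with parameters in `M`:
an `L`-formula `ψ(x, y)` together with a finite tuple `b` of elements of `M` substituted for `y`. -/
structure ParamFormula (L : FirstOrder.Language.{u, v}) (M : Type w) (n : ℕ) where
  /-- the length of the tuple of parameters -/
  arity : ℕ
  /-- the underlying formula without parameters -/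
  formula : L.Formula (Fin n ⊕ Fin arity)
  /-- the parameters -/
  params : Fin arity → M

section

variable {L : FirstOrder.Language.{u, v}} {M : Type w} [L.Structure M]

/-- The tuple `a` satisfies the formula `ψ(x, b)` in `M`. -/
def ParamFormula.Holds {n : ℕ} (ψ : ParamFormula L M n) (a : Fin n → M) : Prop :=
  ψ.formula.Realize (Sum.elim a ψ.params)

/-- The instance `φ(x, b)` of an `L`-formula `φ(x, y)`. -/
def inst {n m : ℕ} (φ : L.Formula (Fin n ⊕ Fin m)) (b : Fin m → M) : ParamFormula L M n :=
  ⟨m, φ, b⟩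

/-- The set of formulas `{φ(x, s_i) | i}`. -/
def instances {n m : ℕ} {ι : Type*} (φ : L.Formula (Fin n ⊕ Fin m)) (s : ι → Fin m → M) :
    Set (ParamFormula L M n) :=
  Set.range fun i => inst φ (s i)

/-- A set of formulas with parameters in `M` is consistent (with the elementary diagram of `M`):
every finite subset is satisfied by some tuple of `M`. -/
def Consistent {n : ℕ} (Γ : Set (ParamFormula L M n)) : Prop :=
  ∀ Δ ⊆ Γ, Δ.Finite → ∃ a : Fin n → M, ∀ ψ ∈ Δ, ψ.Holds a

/-- A set of formulas implies a formula: some finite subset does so in `M`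
(and therefore in every elementary extension of `M`). -/
def Implies {n : ℕ} (Γ : Set (ParamFormula L M n)) (ψ : ParamFormula L M n) : Prop :=
  ∃ Δ ⊆ Γ, Δ.Finite ∧ ∀ a : Fin n → M, (∀ θ ∈ Δ, θ.Holds a) → ψ.Holds a

/-- The complete type `tp(a / B)`. -/
def tp (L : FirstOrder.Language.{u, v}) {M : Type w} [L.Structure M] {n : ℕ} (a : Fin n → M) (B : Set M) :
    Set (ParamFormula L M n) :=
  {ψ | (∀ j, ψ.params j ∈ B) ∧ ψ.Holds a}

/-- `M` is `μ`-saturated: every consistent set of formulas in one variable, with parameters in a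
set of cardinality less than `μ`, is realized in `M`. -/
def IsSaturated (L : FirstOrder.Language.{u, v}) (M : Type w) [L.Structure M] (μ : Cardinal.{w}) : Prop :=
  ∀ A : Set M, #A < μ → ∀ Γ : Set (ParamFormula L M 1), (∀ ψ ∈ Γ, ∀ j, ψ.params j ∈ A) →
    Consistent Γ → ∃ a : Fin 1 → M, ∀ ψ ∈ Γ, ψ.Holds a

/-- `a ≡_A b`: the (possibly infinite) tuples `a` and `b` have the same type over `A`. -/
def SameType (L : FirstOrder.Language.{u, v}) {M : Type w} [L.Structure M] {ι : Type*} (A : Set M)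
    (a b : ι → M) : Prop :=
  ∀ (p : ℕ) (θ : L.Formula (ι ⊕ Fin p)) (e : Fin p → M), (∀ j, e j ∈ A) →
    (θ.Realize (Sum.elim a e) ↔ θ.Realize (Sum.elim b e))

/-- A sequence of `m`-tuples, read as one tuple of elements of `M`. -/
def flatten {ι : Type*} {m : ℕ} (s : ι → Fin m → M) : ι × Fin m → M :=
  fun q => s q.1 q.2

/-- The sequence `⟨s_i | i < ω⟩` of `m`-tuples is indiscernible over `A`. -/
def IsIndiscernible (L : FirstOrder.Language.{u, v}) {M : Type w} [L.Structure M] {m : ℕ} (A : Set M)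
    (s : ℕ → Fin m → M) : Prop :=
  ∀ (k : ℕ) (f g : Fin k ↪o ℕ), SameType L A (flatten (s ∘ f)) (flatten (s ∘ g))

/-- `φ(x, b)` divides over `A`. -/
def ParamFormula.Divides {n : ℕ} (A : Set M) (ψ : ParamFormula L M n) : Prop :=
  ∃ s : ℕ → Fin ψ.arity → M, s 0 = ψ.params ∧ IsIndiscernible L A s ∧
    ¬ Consistent (instances ψ.formula s)

/-- `φ(x, b)` forks over `A`: it implies a finite disjunction of formulas dividing over `A`. -/
def ParamFormula.Forks {n : ℕ} (A : Set M) (ψ : ParamFormula L M n) : Prop :=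
  ∃ F : Set (ParamFormula L M n), F.Finite ∧ (∀ θ ∈ F, θ.Divides A) ∧
    ∀ a : Fin n → M, ψ.Holds a → ∃ θ ∈ F, θ.Holds a

/-- `a ⫝_A B`: the type `tp(a / AB)` does not fork over `A`, that is, it does not imply a formula
that forks over `A`. -/
def Indep (L : FirstOrder.Language.{u, v}) {M : Type w} [L.Structure M] {n : ℕ} (A : Set M) (a : Fin n → M)
    (B : Set M) : Prop :=
  ¬ ∃ ψ : ParamFormula L M n, Implies (tp L a (A ∪ B)) ψ ∧ ψ.Forks A

/-- `⟨s_i | i < ω⟩` is a Morley sequence over `A`: it is `A`-indiscernible and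
`s_i ⫝_A s_{<i}` for every `i`. -/
def IsMorley (L : FirstOrder.Language.{u, v}) {M : Type w} [L.Structure M] {m : ℕ} (A : Set M)
    (s : ℕ → Fin m → M) : Prop :=
  IsIndiscernible L A s ∧ ∀ i, Indep L A (s i) {e | ∃ j < i, e ∈ Set.range (s j)}

/-- The sequence `s` witnesses that `φ(x, b)` Kim-divides over `A`: it is a Morley sequence over
`A` starting with `b`, and `{φ(x, s_i) | i < ω}` is inconsistent. -/
def KimDividesAlong {n m : ℕ} (A : Set M) (φ : L.Formula (Fin n ⊕ Fin m)) (b : Fin m → M)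
    (s : ℕ → Fin m → M) : Prop :=
  s 0 = b ∧ IsMorley L A s ∧ ¬ Consistent (instances φ s)

/-- `φ(x, b)` Kim-divides over `A`. -/
def ParamFormula.KimDivides {n : ℕ} (A : Set M) (ψ : ParamFormula L M n) : Prop :=
  ∃ s : ℕ → Fin ψ.arity → M, KimDividesAlong A ψ.formula ψ.params s

/-- `φ(x, b)` Kim-forks over `A`: it implies a finite disjunction of formulas Kim-dividing
over `A`. -/
def ParamFormula.KimForks {n : ℕ} (A : Set M) (ψ : ParamFormula L M n) : Prop :=
  ∃ F : Set (ParamFormula L M n), F.Finite ∧ (∀ θ ∈ F, θ.KimDivides A) ∧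
    ∀ a : Fin n → M, ψ.Holds a → ∃ θ ∈ F, θ.Holds a

/-- `a ⫝ᴷ_A B`: the type `tp(a / AB)` does not Kim-fork over `A`, that is, it does not imply a
formula that Kim-forks over `A`. -/
def KimIndep (L : FirstOrder.Language.{u, v}) {M : Type w} [L.Structure M] {n : ℕ} (A : Set M)
    (a : Fin n → M) (B : Set M) : Prop :=
  ¬ ∃ ψ : ParamFormula L M n, Implies (tp L a (A ∪ B)) ψ ∧ ψ.KimForks A

/-- `φ(x, y)` has the tree property of the second kind (in `M`). -/
def HasTP2 (M : Type w) [L.Structure M] {n m : ℕ} (φ : L.Formula (Fin n ⊕ Fin m)) : Prop :=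
  ∃ a : ℕ → ℕ → Fin m → M,
    (∀ i j k, j ≠ k → ¬ Consistent {inst φ (a i j), inst φ (a i k)}) ∧
    ∀ f : ℕ → ℕ, Consistent (instances φ fun i => a i (f i))

end

end KimForking

/-! Stretch the TP₂ array to rows indexed by `κ` and columns by `ℚ`, with mutually indiscernible
rows of equal type (`HasTP2.exists_array`). Let `A` be the set of entries in the columns `-1/(t+1)`,
let `c_i` be the entry of row `i` in column `1`, let `J_i` run through the columns `1/(t+1)`, and
let `d` realize the path `{φ(x, c_i)}`. Everything rests on `IsShapeInvariant.indep`: an entry in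
column `q > 0` can be slid left into a negative column without passing a given finite set of
parameters, as long as the parameters in its row that lie outside `A` are to the right of `q`. Its
type is then finitely satisfiable in `A`, hence does not fork over `A`. This makes the `J_i` Morley
sequences, because their columns decrease, and makes `c_i` independent of the other rows.
Kim-dividing of `φ(x, c_i)` is the 2-inconsistency of a row. The array is not extracted by Ramsey's
theorem: its row and column numbers are generic for an iterated nonprincipal ultrafilter, and
saturation realizes the limit type. -/

namespace KimForking

open Filter Function FirstOrder.Language

/-! ### Order-indiscernible generic sequences from iterated ultrafilters. -/

section GenericSequence

variable {W : Type*}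

/-- The ultrafilter on assignments `W → ℕ` that picks the coordinates in the list one after the
other, each of them generic for the hyperfilter on `ℕ`. -/
noncomputable def iteratedHyperfilter [DecidableEq W] : List W → Ultrafilter (W → ℕ)
  | [] => pure 0
  | w :: l => (hyperfilter ℕ).bind fun j => (iteratedHyperfilter l).map fun h => update h w j

lemma eventually_iteratedHyperfilter_cons [DecidableEq W] (w : W) (l : List W)
    (P : (W → ℕ) → Prop) :
    (∀ᶠ h in (iteratedHyperfilter (w :: l) : Filter (W → ℕ)), P h) ↔
      ∀ᶠ j in (hyperfilter ℕ : Filter ℕ),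
        ∀ᶠ h in (iteratedHyperfilter l : Filter (W → ℕ)), P (update h w j) :=
  Iff.rfl

/-- A coordinate outside `l'` does not affect `P`, so averaging over it changes nothing. -/
lemma eventually_iteratedHyperfilter_sublist [DecidableEq W] {l l' : List W} (hl : l'.Sublist l)
    (hnd : l.Nodup) {P : (W → ℕ) → Prop} (hP : DependsOn P {w | w ∈ l'}) :
    (∀ᶠ h in (iteratedHyperfilter l : Filter (W → ℕ)), P h) ↔
      ∀ᶠ h in (iteratedHyperfilter l' : Filter (W → ℕ)), P h := by
  induction hl generalizing P with
  | slnil => rfl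
  | @cons l₁ l₂ w hs ih =>
    rw [List.nodup_cons] at hnd
    rw [eventually_iteratedHyperfilter_cons, ← ih hnd.2 hP]
    have : ∀ (h : W → ℕ) j, P (update h w j) = P h := fun h j => hP fun x hx => by
      refine update_of_ne ?_ _ _
      rintro rfl
      exact hnd.1 (hs.subset hx)
    simp only [this, eventually_const]
  | @cons_cons l₁ l₂ w hs ih =>
    rw [List.nodup_cons] at hnd
    simp only [eventually_iteratedHyperfilter_cons]
    refine eventually_congr (Eventually.of_forall fun j => ih hnd.2 ?_)
    intro h h' hh
    refine hP fun x hx => ?_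
    by_cases hxw : x = w
    · subst hxw; simp
    · rw [update_of_ne hxw, update_of_ne hxw]
      exact hh x (by simpa [hxw] using hx)

/-- Coordinates are only names. Injectivity prevents the outer `update` from overwriting a value
drawn further inside. -/
lemma eventually_iteratedHyperfilter_ofFn [DecidableEq W] {k : ℕ} {α β : Fin k → W}
    (hα : Injective α) (hβ : Injective β) (P : (Fin k → ℕ) → Prop) :
    (∀ᶠ h in (iteratedHyperfilter (List.ofFn α) : Filter (W → ℕ)), P (h ∘ α)) ↔
      ∀ᶠ h in (iteratedHyperfilter (List.ofFn β) : Filter (W → ℕ)), P (h ∘ β) := by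
  induction k with
  | zero =>
    have : ∀ x y : Fin 0 → ℕ, P x = P y := fun x y => congrArg P (Subsingleton.elim _ _)
    simp only [this _ 0, eventually_const]
  | succ k ih =>
    have key : ∀ γ : Fin (k + 1) → W, Injective γ → ∀ (h : W → ℕ) j,
        update h (γ 0) j ∘ γ = (Fin.cons j (h ∘ (γ ∘ Fin.succ)) : Fin (k + 1) → ℕ) := by
      intro γ hγ h j
      ext i
      refine Fin.cases ?_ (fun i => ?_) i
      · simp
      · simp [hγ.ne (Fin.succ_ne_zero i)]
    simp only [List.ofFn_succ, eventually_iteratedHyperfilter_cons, key α hα, key β hβ]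
    exact eventually_congr (Eventually.of_forall fun j =>
      ih (hα.comp (Fin.succ_injective k)) (hβ.comp (Fin.succ_injective k))
        fun x => P (Fin.cons j x))

variable (W) in
/-- The type of a generic increasing sequence of natural numbers indexed by `W`. -/
noncomputable def genericUltrafilter [LinearOrder W] : Ultrafilter (W → ℕ) :=
  (Ultrafilter.of (atTop : Filter (Finset W))).bind fun F => iteratedHyperfilter F.sort

/-- As soon as `F` contains `l`, the sorted list of `F` has `l` as a sublist, so the law on `l` no
longer depends on `F`. -/
lemma eventually_genericUltrafilter [LinearOrder W] {l : List W} (hl : l.SortedLT)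
    {P : (W → ℕ) → Prop} (hP : DependsOn P {w | w ∈ l}) :
    (∀ᶠ h in (genericUltrafilter W : Filter (W → ℕ)), P h) ↔
      ∀ᶠ h in (iteratedHyperfilter l : Filter (W → ℕ)), P h := by
  have hF : ∀ᶠ F in (Ultrafilter.of (atTop : Filter (Finset W)) : Filter (Finset W)),
      l.toFinset ⊆ F :=
    Ultrafilter.of_le _ (eventually_ge_atTop _)
  have key : ∀ᶠ F in (Ultrafilter.of (atTop : Filter (Finset W)) : Filter (Finset W)),
      ((∀ᶠ h in (iteratedHyperfilter F.sort : Filter (W → ℕ)), P h) ↔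
        ∀ᶠ h in (iteratedHyperfilter l : Filter (W → ℕ)), P h) := by
    filter_upwards [hF] with F hF
    refine eventually_iteratedHyperfilter_sublist ?_ (Finset.sort_nodup _ _) hP
    refine List.sublist_of_subperm_of_sortedLE ?_ hl.sortedLE (Finset.pairwise_sort F _).sortedLE
    exact List.subperm_of_subset hl.nodup fun x hx => by
      simpa using hF (List.mem_toFinset.2 hx)
  exact (eventually_congr key).trans eventually_const

lemma eventually_genericUltrafilter_strictMono [LinearOrder W] {k : ℕ} {α β : Fin k → W}
    (hα : StrictMono α) (hβ : StrictMono β) (P : (Fin k → ℕ) → Prop) :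
    (∀ᶠ h in (genericUltrafilter W : Filter (W → ℕ)), P (h ∘ α)) ↔
      ∀ᶠ h in (genericUltrafilter W : Filter (W → ℕ)), P (h ∘ β) := by
  have key : ∀ γ : Fin k → W, StrictMono γ →
      ((∀ᶠ h in (genericUltrafilter W : Filter (W → ℕ)), P (h ∘ γ)) ↔
        ∀ᶠ h in (iteratedHyperfilter (List.ofFn γ) : Filter (W → ℕ)), P (h ∘ γ)) := by
    intro γ hγ
    refine eventually_genericUltrafilter (List.sortedLT_ofFn_iff.2 hγ) fun h h' hh => ?_
    exact congrArg P (funext fun i => hh _ (by simp [List.mem_ofFn]))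
  rw [key α hα, key β hβ]
  exact eventually_iteratedHyperfilter_ofFn hα.injective hβ.injective P

/-- The coordinates of a generic sequence are order indiscernible. -/
theorem eventually_genericUltrafilter_congr [LinearOrder W] {ι : Type*} [Finite ι] {α β : ι → W}
    (hαβ : ∀ x y, α x < α y ↔ β x < β y) (P : (ι → ℕ) → Prop) :
    (∀ᶠ h in (genericUltrafilter W : Filter (W → ℕ)), P (h ∘ α)) ↔
      ∀ᶠ h in (genericUltrafilter W : Filter (W → ℕ)), P (h ∘ β) := by
  classical
  have := Fintype.ofFinite ι
  let F : Finset W := Finset.univ.image α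
  let e := F.orderIsoOfFin rfl
  have hmem : ∀ x, α x ∈ F := fun x => Finset.mem_image_of_mem _ (Finset.mem_univ _)
  have hex : ∀ i, ∃ x, α x = e i := fun i => by
    obtain ⟨x, -, hx⟩ := Finset.mem_image.1 (e i).2
    exact ⟨x, hx⟩
  choose γ hγ using hex
  let s : ι → Fin F.card := fun x => e.symm ⟨α x, hmem x⟩
  have hs : ∀ x, α (γ (s x)) = α x := fun x => by simp [hγ, s]
  -- The order hypothesis makes `β` identify the same indices as `α`, so `β` also factors through
  -- `s`.
  have hs' : ∀ x, β (γ (s x)) = β x := fun x => by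
    refine le_antisymm (not_lt.1 ?_) (not_lt.1 ?_) <;> rw [← hαβ, hs] <;> exact lt_irrefl _
  have hmα : StrictMono (α ∘ γ) := fun i j hij => by
    simpa [hγ] using hij
  have hmβ : StrictMono (β ∘ γ) := fun i j hij => (hαβ _ _).1 (hmα hij)
  have := eventually_genericUltrafilter_strictMono hmα hmβ fun x => P (x ∘ s)
  have h1 : ∀ h : W → ℕ, (h ∘ α ∘ γ) ∘ s = h ∘ α := fun h => funext fun x => by simp [hs]
  have h2 : ∀ h : W → ℕ, (h ∘ β ∘ γ) ∘ s = h ∘ β := fun h => funext fun x => by simp [hs']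
  simpa only [h1, h2] using this

/-- The later coordinate is drawn after the earlier one, and a nonprincipal ultrafilter avoids the
finitely many values up to it. -/
lemma eventually_genericUltrafilter_lt [LinearOrder W] {w w' : W} (hw : w < w') :
    ∀ᶠ h in (genericUltrafilter W : Filter (W → ℕ)), h w < h w' := by
  rw [eventually_genericUltrafilter (l := [w, w']) (by
    simpa [List.sortedLT_iff_pairwise] using hw)]
  · simp only [eventually_iteratedHyperfilter_cons]
    refine Eventually.of_forall fun j => ?_
    have : ∀ᶠ j' in (hyperfilter ℕ : Filter ℕ), j < j' :=
      (Nat.hyperfilter_le_atTop) (eventually_gt_atTop j)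
    filter_upwards [this] with j' hj'
    refine Eventually.of_forall fun h => ?_
    simpa [update_of_ne hw.ne'] using hj'
  · intro h h' hh
    simp only [hh w (by simp), hh w' (by simp)]

lemma eventually_genericUltrafilter_ne [LinearOrder W] {w w' : W} (hw : w ≠ w') :
    ∀ᶠ h in (genericUltrafilter W : Filter (W → ℕ)), h w ≠ h w' := by
  rcases hw.lt_or_gt with hlt | hgt
  · exact (eventually_genericUltrafilter_lt hlt).mono fun _ => ne_of_lt
  · exact (eventually_genericUltrafilter_lt hgt).mono fun _ => ne_of_gt

end GenericSequence

/-! ### Realizing limit types in a saturated structure. -/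

section Saturation

variable {L : FirstOrder.Language.{u, v}} {M : Type w} [L.Structure M]

lemma exists_finite_support {V : Type*} (θ : L.Formula V) :
    ∃ (p : ℕ) (e : Fin p → V) (θ' : L.Formula (Fin p)),
      ∀ g : V → M, θ.Realize g ↔ θ'.Realize (g ∘ e) := by
  classical
  let s := θ.freeVarFinset
  let f := s.equivFin
  refine ⟨s.card, fun j => f.symm j, BoundedFormula.restrictFreeVar θ f, fun g => ?_⟩
  exact (BoundedFormula.realize_restrictFreeVar g (by simp [s])).symm

/-- `R` is the graph of a partial assignment `V → M` that satisfies every formula which holds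
along the filter `D` of assignments. -/
def IsPartialRealization (L : FirstOrder.Language.{u, v}) {M : Type w} [L.Structure M]
    {V : Type*} (D : Filter (V → M)) (R : Set (V × M)) : Prop :=
  ∀ (p : ℕ) (θ : L.Formula (Fin p)) (e : Fin p → V × M), (∀ j, e j ∈ R) →
    (∀ᶠ h in D, θ.Realize fun j => h (e j).1) → θ.Realize fun j => (e j).2

namespace IsPartialRealization

variable {V : Type*} {D : Filter (V → M)} {R : Set (V × M)}

lemma realize (hR : IsPartialRealization L D R) {ι : Type*} (θ : L.Formula ι)
    (e : ι → V × M) (he : ∀ j, e j ∈ R) (h : ∀ᶠ h in D, θ.Realize fun j => h (e j).1) :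
    θ.Realize fun j => (e j).2 := by
  obtain ⟨p, s, θ', hθ⟩ := exists_finite_support (M := M) θ
  simp only [hθ] at h ⊢
  exact hR p θ' (e ∘ s) (fun j => he _) h

/-- The formula `v₀ = v₁` holds along `D` when both variables are read as `x`. This bounds the
number of values in `R` by the number of variables. -/
lemma functional (hR : IsPartialRealization L D R) {x : V} {a b : M} (ha : (x, a) ∈ R)
    (hb : (x, b) ∈ R) : a = b := by
  have := hR.realize (Term.equal (Term.var 0) (Term.var 1)) ![(x, a), (x, b)]
    (by intro j; fin_cases j <;> simpa) (by simp [Formula.realize_equal])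
  simpa [Formula.realize_equal] using this

/-- Saturation is applied to the limit type of `h x` over the values in `R`. A finite part of it is
consistent because its existential closure speaks only of `R` and holds along `D`. -/
lemma exists_insert (hR : IsPartialRealization L D R) [D.NeBot] {μ : Cardinal.{w}}
    (hsat : IsSaturated L M μ) (hRμ : #(Prod.snd '' R) < μ) (x : V) :
    ∃ a, IsPartialRealization L D (insert (x, a) R) := by
  classical
  let Γ : Set (ParamFormula L M 1) := {ψ | ∃ e : Fin ψ.arity → V,
    (∀ j, (e j, ψ.params j) ∈ R) ∧
      ∀ᶠ h in D, ψ.formula.Realize (Sum.elim (fun _ => h x) (h ∘ e))}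
  have hΓ : Consistent Γ := by
    intro Δ hΔ hfin
    have := hfin.to_subtype
    choose e heR heD using fun ψ : Δ => hΔ ψ.2
    let χ : L.Formula (Σ ψ : Δ, Fin ψ.1.arity) := Formula.iExs (Fin 1) (Formula.iInf fun ψ : Δ =>
      ψ.1.formula.relabel (Sum.elim Sum.inr fun j => Sum.inl ⟨ψ, j⟩))
    have hχ : ∀ g : (Σ ψ : Δ, Fin ψ.1.arity) → M, χ.Realize g ↔
        ∃ a : Fin 1 → M, ∀ ψ : Δ, ψ.1.formula.Realize (Sum.elim a fun j => g ⟨ψ, j⟩) := by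
      intro g
      simp only [χ, Formula.realize_iExs, Formula.realize_iInf, Formula.realize_relabel]
      refine exists_congr fun a => forall_congr' fun ψ => ?_
      refine iff_of_eq (congrArg _ ?_)
      ext i
      cases i <;> rfl
    have h1 := hR.realize χ (fun q => (e q.1 q.2, q.1.1.params q.2)) (fun q => heR _ _) (by
      filter_upwards [eventually_all.2 heD] with h hh
      exact (hχ _).2 ⟨_, hh⟩)
    obtain ⟨a, ha⟩ := (hχ _).1 h1
    exact ⟨a, fun ψ hψ => ha ⟨ψ, hψ⟩⟩
  obtain ⟨a, ha⟩ := hsat _ hRμ Γ (fun ψ ⟨e, he, _⟩ j => ⟨_, he j, rfl⟩) hΓ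
  refine ⟨a 0, fun p θ e he hθ => ?_⟩
  -- Entries of `e` in `R` become parameters; all others are the new pair and become the single
  -- variable.
  let f := Fintype.equivFin {j // e j ∈ R}
  let r : Fin p → Fin 1 ⊕ Fin (Fintype.card {j // e j ∈ R}) := fun j =>
    if hj : e j ∈ R then Sum.inr (f ⟨j, hj⟩) else Sum.inl 0
  have hr : ∀ (c : V × M → M) (b : M), (∀ j, e j ∉ R → c (e j) = b) →
      Sum.elim (fun _ => b) (fun j => c (e (f.symm j).1)) ∘ r = fun j => c (e j) := by
    intro c b hc
    ext j
    by_cases hj : e j ∈ R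
    · simp [r, hj]
    · simp [r, hj, hc j hj]
  have hx : ∀ j, e j ∉ R → e j = (x, a 0) := fun j hj => (he j).resolve_right hj
  have key := ha ⟨_, θ.relabel r, fun j => (e (f.symm j).1).2⟩
    ⟨fun j => (e (f.symm j).1).1, fun j => (f.symm j).2, by
      filter_upwards [hθ] with h hh
      rw [Formula.realize_relabel]
      have := hr (fun z => h z.1) (h x) fun j hj => by rw [hx j hj]
      exact this ▸ hh⟩
  have h2 := hr Prod.snd (a 0) fun j hj => by rw [hx j hj]
  rw [ParamFormula.Holds, Formula.realize_relabel] at key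
  have h3 : (fun _ => a 0 : Fin 1 → M) = a := funext fun i => congrArg a (Subsingleton.elim _ _)
  rw [h3] at h2
  rwa [← h2]

end IsPartialRealization

/-- In a `μ`-saturated structure, the limit type of fewer than `μ` variables along an ultrafilter
of assignments is realized. -/
theorem IsSaturated.exists_realize_iff {μ : Cardinal.{w}} (hsat : IsSaturated L M μ) {V : Type w}
    (hV : #V < μ) (D : Ultrafilter (V → M)) :
    ∃ g : V → M, ∀ θ : L.Formula V, θ.Realize g ↔ ∀ᶠ h in (D : Filter (V → M)), θ.Realize h := by
  obtain ⟨R, hR⟩ := zorn_subset {R | IsPartialRealization L (D : Filter (V → M)) R} <| by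
    intro c hc hchain
    refine ⟨⋃₀ c, fun p θ e he hθ => ?_, fun s hs => Set.subset_sUnion_of_mem hs⟩
    -- For the empty chain only sentences matter, and their truth does not depend on the assignment.
    rcases c.eq_empty_or_nonempty with rfl | hne
    · obtain ⟨h, hh⟩ := hθ.exists
      rcases p with _ | p
      · exact (Subsingleton.elim (fun j => h (e j).1) fun j => (e j).2) ▸ hh
      · simpa using he 0
    · choose t ht het using he
      obtain ⟨s, hs, hsub⟩ := (hchain.directedOn).exists_mem_subset_of_finite_of_subset_sUnion hne
        (Set.finite_range e) (by rintro _ ⟨j, rfl⟩; exact ⟨_, ht j, het j⟩)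
      exact hc hs p θ e (fun j => hsub ⟨j, rfl⟩) hθ
  have hR' : IsPartialRealization L (D : Filter (V → M)) R := hR.prop
  have hcard : #(Prod.snd '' R) < μ := by
    refine (mk_image_le.trans ?_).trans_lt hV
    refine mk_le_of_injective (f := fun z : R => z.1.1) ?_
    rintro ⟨⟨x, a⟩, ha⟩ ⟨⟨y, b⟩, hb⟩ (rfl : x = y)
    have := hR'.functional ha hb
    subst this
    rfl
  have htot : ∀ x, ∃ a, (x, a) ∈ R := fun x => by
    obtain ⟨a, ha⟩ := hR'.exists_insert hsat hcard x
    exact ⟨a, hR.le_of_ge ha (Set.subset_insert _ _) (Set.mem_insert _ _)⟩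
  choose g hg using htot
  have hreal : ∀ θ : L.Formula V, (∀ᶠ h in (D : Filter (V → M)), θ.Realize h) → θ.Realize g :=
    fun θ hθ => hR'.realize θ (fun x => (x, g x)) hg hθ
  refine ⟨g, fun θ => ⟨fun h => ?_, hreal θ⟩⟩
  by_contra hcon
  rw [← Ultrafilter.eventually_not] at hcon
  exact Formula.realize_not.1 (hreal θ.not (hcon.mono fun _ => Formula.realize_not.2)) h

end Saturation

/-! ### Criteria for forking and Kim-forking. -/

section Independence

variable {L : FirstOrder.Language.{u, v}} {M : Type w} [L.Structure M]

lemma ParamFormula.KimDivides.divides {n : ℕ} {A : Set M} {ψ : ParamFormula L M n}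
    (h : ψ.KimDivides A) : ψ.Divides A :=
  let ⟨s, h0, hs, hc⟩ := h
  ⟨s, h0, hs.1, hc⟩

lemma ParamFormula.KimForks.forks {n : ℕ} {A : Set M} {ψ : ParamFormula L M n}
    (h : ψ.KimForks A) : ψ.Forks A :=
  let ⟨F, hF, hd, hi⟩ := h
  ⟨F, hF, fun θ hθ => (hd θ hθ).divides, hi⟩

lemma Indep.kimIndep {n : ℕ} {A B : Set M} {a : Fin n → M} (h : Indep L A a B) :
    KimIndep L A a B :=
  fun ⟨ψ, hψ, hf⟩ => h ⟨ψ, hψ, hf.forks⟩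

/-- Indiscernibility over `A` would carry `ψ(a, b)` to every term of the sequence, so `a` would
realize all instances. -/
lemma ParamFormula.Divides.not_holds {n : ℕ} {A : Set M} {ψ : ParamFormula L M n}
    (h : ψ.Divides A) {a : Fin n → M} (ha : ∀ j, a j ∈ A) : ¬ ψ.Holds a := by
  obtain ⟨s, h0, hs, hc⟩ := h
  refine fun hψ => hc fun Δ hΔ _ => ⟨a, fun θ hθ => ?_⟩
  obtain ⟨i, rfl⟩ := hΔ hθ
  let f : ℕ → (Fin 1 ↪o ℕ) := fun i => OrderEmbedding.ofStrictMono (fun _ => i)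
    (Subsingleton.strictMono _)
  let r : Fin n ⊕ Fin ψ.arity → (Fin 1 × Fin ψ.arity) ⊕ Fin n :=
    Sum.elim Sum.inr fun j => Sum.inl (0, j)
  have hr : ∀ i, (ψ.formula.relabel r).Realize (Sum.elim (flatten (s ∘ f i)) a) ↔
      ψ.formula.Realize (Sum.elim a (s i)) := fun i => by
    rw [Formula.realize_relabel]
    refine iff_of_eq (congrArg _ ?_)
    ext x
    cases x <;> rfl
  have := hs 1 (f 0) (f i) n (ψ.formula.relabel r) a ha
  rw [hr, hr, h0] at this
  exact this.1 hψ

/-- A type over `A ∪ B` that is finitely satisfiable in `A` does not fork over `A`. -/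
theorem indep_of_finitely_satisfiable {n : ℕ} {A B : Set M} {a : Fin n → M}
    (h : ∀ Δ ⊆ tp L a (A ∪ B), Δ.Finite →
      ∃ a' : Fin n → M, (∀ j, a' j ∈ A) ∧ ∀ ψ ∈ Δ, ψ.Holds a') :
    Indep L A a B := by
  rintro ⟨ψ, ⟨Δ, hΔ, hfin, himp⟩, F, -, hdiv, hF⟩
  obtain ⟨a', haA, ha'⟩ := h Δ hΔ hfin
  obtain ⟨θ, hθ, hh⟩ := hF a' (himp a' ha')
  exact (hdiv θ hθ).not_holds haA hh

lemma not_kimIndep_of_kimDivides {n m : ℕ} {A : Set M} {φ : L.Formula (Fin n ⊕ Fin m)}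
    {b : Fin m → M} (hb : (inst φ b).KimDivides A) {d : Fin n → M} (hd : (inst φ b).Holds d) :
    ¬ KimIndep L A d (Set.range b) := fun h =>
  h ⟨inst φ b, ⟨{inst φ b}, by
    rintro _ rfl
    exact ⟨fun j => Or.inr ⟨j, rfl⟩, hd⟩, Set.finite_singleton _, fun a ha => ha _ rfl⟩,
    {inst φ b}, Set.finite_singleton _, by rintro _ rfl; exact hb, fun a ha => ⟨_, rfl, ha⟩⟩

end Independence

/-! ### The mutually indiscernible array. -/

section Array

/-- Two families of positions in an array have the same shape: the rows are ordered in the same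
way, and within each row the columns are ordered in the same way. -/
def SameShape {K ι : Type*} [LT K] (α β : ι → K × ℚ) : Prop :=
  (∀ x y, (α x).1 < (α y).1 ↔ (β x).1 < (β y).1) ∧
    ∀ x y, (α x).1 = (α y).1 → ((α x).2 < (α y).2 ↔ (β x).2 < (β y).2)

variable {L : FirstOrder.Language.{u, v}} {M : Type w} [L.Structure M]

/-- The rows of the array `g` are mutually indiscernible and have the same type. -/
def IsShapeInvariant (L : FirstOrder.Language.{u, v}) {M : Type w} [L.Structure M]
    {K : Type*} [LT K] {m : ℕ} (g : K × ℚ → Fin m → M) : Prop :=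
  ∀ {ι : Type} [Finite ι] {α β : ι → K × ℚ}, SameShape α β → ∀ θ : L.Formula (ι × Fin m),
    θ.Realize (flatten (g ∘ α)) ↔ θ.Realize (flatten (g ∘ β))

/-- The array indexed by `K × ℚ` that is obtained from an array `a` indexed by `ℕ × ℕ` by choosing
a row of `a` for each `i : K` and, inside this row, a column of `a` for each `q : ℚ`. -/
def subarray {K : Type*} {m : ℕ} (a : ℕ → ℕ → Fin m → M) (h : K ×ₗ WithBot ℚ → ℕ) (v : K × ℚ) :
    Fin m → M :=
  a (h (toLex (v.1, ⊥))) (h (toLex (v.1, (v.2 : WithBot ℚ))))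

/-- Block `i` of the lexicographic order starts with the row coordinate `(i, ⊥)`, followed by its
column coordinates. Hence equal shapes give equally ordered coordinates. -/
lemma eventually_subarray_congr {K ι : Type*} [LinearOrder K] [Finite ι] {m : ℕ}
    (a : ℕ → ℕ → Fin m → M) {α β : ι → K × ℚ} (hαβ : SameShape α β)
    (P : (ι → Fin m → M) → Prop) :
    (∀ᶠ h in (genericUltrafilter (K ×ₗ WithBot ℚ) : Filter (K ×ₗ WithBot ℚ → ℕ)), P (subarray a h ∘ α)) ↔
      ∀ᶠ h in (genericUltrafilter (K ×ₗ WithBot ℚ) : Filter (K ×ₗ WithBot ℚ → ℕ)), P (subarray a h ∘ β) := by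
  let pos : (ι → K × ℚ) → ι ⊕ ι → K ×ₗ WithBot ℚ := fun γ =>
    Sum.elim (fun x => toLex ((γ x).1, ⊥)) fun x => toLex ((γ x).1, ((γ x).2 : WithBot ℚ))
  have heq : ∀ x y, (α x).1 = (α y).1 ↔ (β x).1 = (β y).1 := fun x y => by
    have h1 := hαβ.1 x y
    have h2 := hαβ.1 y x
    constructor <;> intro h
    · exact le_antisymm (not_lt.1 (h2.not.1 h.not_gt)) (not_lt.1 (h1.not.1 h.not_lt))
    · exact le_antisymm (not_lt.1 (h2.not.2 h.not_gt)) (not_lt.1 (h1.not.2 h.not_lt))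
  refine eventually_genericUltrafilter_congr (α := pos α) (β := pos β) ?_
    fun z => P fun x => a (z (Sum.inl x)) (z (Sum.inr x))
  rintro (x | x) (y | y) <;>
    simp only [pos, Sum.elim_inl, Sum.elim_inr, Prod.Lex.toLex_lt_toLex, hαβ.1 x y, ← heq x y] <;>
    refine or_congr_right (and_congr_right fun h => ?_) <;>
    simp [WithBot.coe_lt_coe, hαβ.2 x y h]

/-- A formula with the tree property of the second kind has it along a mutually indiscernible
array of arbitrary size below the saturation of the structure. -/
theorem HasTP2.exists_array {n m : ℕ} {φ : L.Formula (Fin n ⊕ Fin m)} (hφ : HasTP2 M φ)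
    {μ : Cardinal.{w}} (hsat : IsSaturated L M μ) (K : Type w) [LinearOrder K]
    (hK : ℵ₀ ≤ #K) (hKμ : #K < μ) :
    ∃ (g : K × ℚ → Fin m → M) (d : Fin n → M),
      IsShapeInvariant L g ∧
      (∀ i q q', q ≠ q' → ¬ ∃ x, (inst φ (g (i, q))).Holds x ∧ (inst φ (g (i, q'))).Holds x) ∧
      ∀ i, (inst φ (g (i, 1))).Holds d := by
  classical
  obtain ⟨a, hincons, hcons⟩ := hφ
  have : Nonempty (Fin n → M) :=
    let ⟨x, _⟩ := hcons 0 ∅ (Set.empty_subset _) Set.finite_empty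
    ⟨x⟩
  -- A realization of the part of the path in the rows of `F`; it exists for almost all `h`, and its
  -- limit over `F` is `d`.
  let X : Finset K → (K ×ₗ WithBot ℚ → ℕ) → Fin n → M := fun F h =>
    Classical.epsilon fun x => ∀ i ∈ F, (inst φ (subarray a h (i, 1))).Holds x
  let D : Ultrafilter (((K × ℚ) × Fin m) ⊕ Fin n → M) :=
    (Ultrafilter.of (atTop : Filter (Finset K))).bind fun F =>
      (genericUltrafilter (K ×ₗ WithBot ℚ)).map fun h =>
        Sum.elim (flatten (subarray a h)) (X F h)
  have hD : ∀ P : (((K × ℚ) × Fin m) ⊕ Fin n → M) → Prop, (∀ᶠ z in (D : Filter _), P z) ↔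
      ∀ᶠ F in (Ultrafilter.of (atTop : Filter (Finset K)) : Filter (Finset K)),
        ∀ᶠ h in (genericUltrafilter (K ×ₗ WithBot ℚ) : Filter (K ×ₗ WithBot ℚ → ℕ)),
          P (Sum.elim (flatten (subarray a h)) (X F h)) := fun P => Iff.rfl
  have hcard : #(((K × ℚ) × Fin m) ⊕ Fin n) < μ := by
    have hμ := hK.trans_lt hKμ
    simp only [mk_sum, mk_prod, mk_fin, lift_natCast, Cardinal.mkRat, lift_aleph0,
      lift_uzero]
    exact add_lt_of_lt hμ.le (mul_lt_of_lt hμ.le (mul_lt_of_lt hμ.le hKμ hμ)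
      (natCast_lt_aleph0.trans hμ)) (natCast_lt_aleph0.trans hμ)
  obtain ⟨G, hG⟩ := hsat.exists_realize_iff hcard D
  have hG' : ∀ {κ : Type} (θ : L.Formula κ) (e : κ → (K × ℚ) × Fin m),
      θ.Realize (G ∘ Sum.inl ∘ e) ↔
        ∀ᶠ h in (genericUltrafilter (K ×ₗ WithBot ℚ) : Filter (K ×ₗ WithBot ℚ → ℕ)),
          θ.Realize (flatten (subarray a h) ∘ e) := by
    intro κ θ e
    have := hG (θ.relabel (Sum.inl ∘ e))
    rw [Formula.realize_relabel, hD] at this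
    simpa only [Formula.realize_relabel, ← Function.comp_assoc, Sum.elim_comp_inl,
      eventually_const] using this
  refine ⟨fun v l => G (Sum.inl (v, l)), fun j => G (Sum.inr j), ?_, ?_, ?_⟩
  · intro ι _ α β hαβ θ
    have := eventually_subarray_congr a hαβ fun z => θ.Realize (flatten z)
    exact (hG' θ fun q => (α q.1, q.2)).trans (this.trans (hG' θ fun q => (β q.1, q.2)).symm)
  · intro i q q' hq
    let χ : L.Formula (Fin 2 × Fin m) := Formula.iExs (Fin n)
      (φ.relabel (Sum.elim Sum.inr fun l => Sum.inl (0, l)) ⊓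
        φ.relabel (Sum.elim Sum.inr fun l => Sum.inl (1, l)))
    have hχ : ∀ z : Fin 2 × Fin m → M, χ.Realize z ↔
        ∃ x, (inst φ fun l => z (0, l)).Holds x ∧ (inst φ fun l => z (1, l)).Holds x := by
      intro z
      simp only [χ, Formula.realize_iExs, Formula.realize_inf, Formula.realize_relabel]
      refine exists_congr fun x => and_congr ?_ ?_ <;>
        refine iff_of_eq (congrArg _ ?_) <;> ext i <;> cases i <;> rfl
    have h1 := hG' χ.not fun z => (![(i, q), (i, q')] z.1, z.2)
    rw [Formula.realize_not, hχ] at h1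
    refine h1.2 ?_
    have hne : toLex (i, (q : WithBot ℚ)) ≠ toLex (i, (q' : WithBot ℚ)) := by simpa using hq
    filter_upwards [eventually_genericUltrafilter_ne hne] with h hh
    rw [Formula.realize_not, hχ]
    rintro ⟨x, hx, hx'⟩
    refine hincons (h (toLex (i, ⊥))) _ _ hh fun Δ hΔ _ => ⟨x, fun ψ hψ => ?_⟩
    rcases hΔ hψ with rfl | rfl
    exacts [hx, hx']
  · intro i
    have h1 := hG (φ.relabel (Sum.elim Sum.inr fun l => Sum.inl ((i, 1), l)))
    rw [Formula.realize_relabel, hD] at h1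
    have hrel : ∀ z : ((K × ℚ) × Fin m) ⊕ Fin n → M,
        z ∘ Sum.elim Sum.inr (fun l => Sum.inl ((i, 1), l)) =
          Sum.elim (fun j => z (Sum.inr j)) (fun l : Fin m => z (Sum.inl ((i, 1), l))) := by
      intro z
      ext x
      cases x <;> rfl
    simp only [Formula.realize_relabel, hrel] at h1
    refine h1.2 ?_
    have hF : ∀ᶠ F in (Ultrafilter.of (atTop : Filter (Finset K)) : Filter (Finset K)),
        {i} ⊆ F := Ultrafilter.of_le _ (eventually_ge_atTop _)
    filter_upwards [hF] with F hF
    have hinj : ∀ᶠ h in (genericUltrafilter (K ×ₗ WithBot ℚ) : Filter (K ×ₗ WithBot ℚ → ℕ)),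
        ∀ p : F × F, p.1 ≠ p.2 →
          h (toLex ((p.1 : K), (⊥ : WithBot ℚ))) ≠ h (toLex ((p.2 : K), (⊥ : WithBot ℚ))) := by
      refine eventually_all.2 fun p => eventually_imp_distrib_left.2 fun hp => ?_
      exact eventually_genericUltrafilter_ne fun heq =>
        hp (Subtype.ext (congrArg (fun z => (ofLex z).1) heq))
    filter_upwards [hinj] with h hh
    have hinj' : Injective fun k : F => h (toLex ((k : K), (⊥ : WithBot ℚ))) := fun k k' hk => by
      by_contra hne
      exact hh (k, k') hne hk
    -- Distinct rows of `F` received distinct row numbers, so their chosen columns define a path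
    -- through the original array; the value `0` elsewhere is arbitrary.
    let f : ℕ → ℕ := Function.extend (fun k : F => h (toLex ((k : K), (⊥ : WithBot ℚ))))
      (fun k : F => h (toLex ((k : K), ((1 : ℚ) : WithBot ℚ)))) 0
    have hf : ∀ k ∈ F, subarray a h (k, 1) = a (h (toLex (k, ⊥))) (f (h (toLex (k, ⊥)))) :=
      fun k hk => by
        have := hinj'.extend_apply
          (fun k : F => h (toLex ((k : K), ((1 : ℚ) : WithBot ℚ)))) 0 ⟨k, hk⟩
        exact congrArg (a _) this.symm
    have hex : ∃ x, ∀ k ∈ F, (inst φ (subarray a h (k, 1))).Holds x := by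
      obtain ⟨x, hx⟩ := hcons f ((fun k => inst φ (subarray a h (k, 1))) '' F) (by
        rintro _ ⟨k, hk, rfl⟩
        exact ⟨h (toLex (k, ⊥)), congrArg (inst φ) (hf k hk).symm⟩) (F.finite_toSet.image _)
      exact ⟨x, fun k hk => hx _ ⟨k, hk, rfl⟩⟩
    exact Classical.epsilon_spec hex i (hF (Finset.mem_singleton_self i))

end Array

/-! ### Base set, Morley sequences and independence in the array. -/

section MutuallyIndiscernible

variable {L : FirstOrder.Language.{u, v}} {M : Type w} [L.Structure M]

/-- An increasing sequence of negative rationals. -/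
def negColumn (t : ℕ) : ℚ := -(1 / ((t : ℚ) + 1))

/-- A decreasing sequence of positive rationals. -/
def posColumn (t : ℕ) : ℚ := 1 / ((t : ℚ) + 1)

lemma posColumn_pos (t : ℕ) : 0 < posColumn t := by unfold posColumn; positivity

lemma negColumn_neg (t : ℕ) : negColumn t < 0 := neg_lt_zero.2 (posColumn_pos t)

lemma posColumn_lt_posColumn {s t : ℕ} : posColumn s < posColumn t ↔ t < s := by
  unfold posColumn
  rw [one_div_lt_one_div (by positivity) (by positivity)]
  simp

lemma negColumn_lt_negColumn {s t : ℕ} : negColumn s < negColumn t ↔ s < t :=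
  neg_lt_neg_iff.trans posColumn_lt_posColumn

@[simp] lemma posColumn_zero : posColumn 0 = 1 := by simp [posColumn]

/-- The elements of the array in the negative columns. -/
def arrayBase {K : Type*} {m : ℕ} (g : K × ℚ → Fin m → M) : Set M :=
  Set.range fun z : K × ℕ × Fin m => g (z.1, negColumn z.2.1) z.2.2

lemma mk_arrayBase_le {K : Type w} (hK : ℵ₀ ≤ #K) {m : ℕ} (g : K × ℚ → Fin m → M) :
    #(arrayBase g) ≤ #K := by
  refine mk_range_le.trans ?_
  simp only [mk_prod, mk_fin, lift_natCast, mk_nat, lift_aleph0, lift_uzero, lift_mul]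
  exact mul_le_of_le hK le_rfl (mul_le_of_le hK hK (natCast_lt_aleph0.le.trans hK))

namespace IsShapeInvariant

variable {K : Type*} [LinearOrder K] {m : ℕ} {g : K × ℚ → Fin m → M}

lemma realize_iff (hg : IsShapeInvariant L g) {ι : Type} [Finite ι] {α β : ι → K × ℚ} {p : ℕ}
    {pos : Fin p → K × ℚ} (h : SameShape (Sum.elim α pos) (Sum.elim β pos)) (l : Fin p → Fin m)
    (θ : L.Formula ((ι × Fin m) ⊕ Fin p)) :
    θ.Realize (Sum.elim (flatten (g ∘ α)) fun j => g (pos j) (l j)) ↔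
      θ.Realize (Sum.elim (flatten (g ∘ β)) fun j => g (pos j) (l j)) := by
  have := hg h (θ.relabel
    (Sum.elim (fun q => (Sum.inl q.1, q.2)) fun j => (Sum.inr j, l j)))
  simp only [Formula.realize_relabel] at this
  convert this using 2 <;> ext x <;> cases x <;> rfl

/-- All parameters sit in negative columns, so changing the positive columns while keeping their
order preserves the shape. -/
lemma isIndiscernible (hg : IsShapeInvariant L g) (i : K) :
    IsIndiscernible L (arrayBase g) fun t => g (i, posColumn t) := by
  intro k f f' p θ e he
  choose z hz using he
  obtain rfl : (fun j => g ((z j).1, negColumn (z j).2.1) (z j).2.2) = e := funext hz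
  refine hg.realize_iff (α := fun x => (i, posColumn (f x))) (β := fun x => (i, posColumn (f' x)))
    (pos := fun j => ((z j).1, negColumn (z j).2.1)) ⟨?_, ?_⟩ (fun j => (z j).2.2) θ
  · rintro (x | x) (y | y) <;> exact Iff.rfl
  · rintro (x | x) (y | y) - <;> simp only [Sum.elim_inl, Sum.elim_inr]
    · simp [posColumn_lt_posColumn]
    · exact iff_of_false ((negColumn_neg _).trans (posColumn_pos _)).not_gt
        ((negColumn_neg _).trans (posColumn_pos _)).not_gt
    · exact iff_of_true ((negColumn_neg _).trans (posColumn_pos _))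
        ((negColumn_neg _).trans (posColumn_pos _))

lemma indep (hg : IsShapeInvariant L g) {i : K} {q : ℚ} (hq : 0 < q) {B : Set M}
    (hB : ∀ b ∈ B, ∃ pos l, g pos l = b ∧ (pos.1 = i → q < pos.2)) :
    Indep L (arrayBase g) (g (i, q)) B := by
  refine indep_of_finitely_satisfiable fun Δ hΔ hfin => ?_
  -- For large `t`, the base parameters of row `i` lie left of `negColumn t` and those from `B`
  -- right of `q`, so none separates the two columns.
  have key : ∀ ψ ∈ Δ, ∀ᶠ t in atTop, ψ.Holds (g (i, negColumn t)) := by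
    intro ψ hψ
    have hpar : ∀ j, ∃ pos l, g pos l = ψ.params j ∧
        ∀ᶠ t in atTop, pos.1 = i → (pos.2 < q ↔ pos.2 < negColumn t) ∧
          (q < pos.2 ↔ negColumn t < pos.2) := by
      intro j
      rcases (hΔ hψ).1 j with ⟨⟨i', s, l⟩, h⟩ | h
      · refine ⟨_, _, h, ?_⟩
        filter_upwards [eventually_gt_atTop s] with t ht _
        have h1 := (negColumn_neg s).trans hq
        have h2 := negColumn_lt_negColumn.2 ht
        exact ⟨iff_of_true h1 h2, iff_of_false h1.not_gt h2.not_gt⟩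
      · obtain ⟨pos, l, h, hlt⟩ := hB _ h
        refine ⟨pos, l, h, Eventually.of_forall fun t hi => ?_⟩
        have h1 := hlt hi
        have h2 := (negColumn_neg t).trans (hq.trans h1)
        exact ⟨iff_of_false h1.not_gt h2.not_gt, iff_of_true h1 h2⟩
    choose pos l hpl hev using hpar
    filter_upwards [eventually_all.2 hev] with t ht
    have hshape : SameShape (Sum.elim (fun _ : Unit => (i, q)) pos)
        (Sum.elim (fun _ : Unit => (i, negColumn t)) pos) := by
      constructor
      · rintro (x | x) (y | y) <;> exact Iff.rfl
      · rintro (x | x) (y | y) hxy <;> simp only [Sum.elim_inl, Sum.elim_inr] at hxy ⊢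
        · simp
        · exact (ht y hxy.symm).2
        · exact (ht x hxy).1
    have h1 := hg.realize_iff hshape l
      (ψ.formula.relabel (Sum.map (fun x => ((), x)) id))
    simp only [Formula.realize_relabel, hpl] at h1
    have h2 : ∀ c : K × ℚ,
        Sum.elim (flatten (g ∘ fun _ : Unit => c)) (fun j => ψ.params j) ∘
          Sum.map (fun x => ((), x)) id = Sum.elim (g c) ψ.params := fun c => by
      ext x
      cases x <;> rfl
    rw [h2, h2] at h1
    exact h1.1 (hΔ hψ).2
  obtain ⟨t, ht⟩ := ((eventually_all_finite hfin).2 key).exists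
  exact ⟨g (i, negColumn t), fun l => ⟨(i, t, l), rfl⟩, ht⟩

lemma isMorley (hg : IsShapeInvariant L g) (i : K) :
    IsMorley L (arrayBase g) fun t => g (i, posColumn t) := by
  refine ⟨hg.isIndiscernible i, fun t => hg.indep (posColumn_pos t) ?_⟩
  rintro _ ⟨s, hs, l, rfl⟩
  exact ⟨_, l, rfl, fun _ => posColumn_lt_posColumn.2 hs⟩

lemma sameType_row (hg : IsShapeInvariant L g) (i k : K) :
    SameType L ∅ (flatten fun t => g (i, posColumn t)) (flatten fun t => g (k, posColumn t)) := by
  intro p θ e he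
  rcases p with _ | p
  · obtain ⟨p, s, θ', hθ⟩ := exists_finite_support (M := M) θ
    have hs : ∀ j, ∃ z, s j = Sum.inl z := fun j => by
      rcases s j with z | z
      exacts [⟨z, rfl⟩, z.elim0]
    choose z hz using hs
    obtain rfl : s = fun j => Sum.inl (z j) := funext hz
    have := hg (α := fun j => (i, posColumn (z j).1)) (β := fun j => (k, posColumn (z j).1))
      ⟨fun x y => by simp, fun x y _ => Iff.rfl⟩ (θ'.relabel fun j => (j, (z j).2))
    rw [Formula.realize_relabel, Formula.realize_relabel] at this
    rw [hθ, hθ]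
    exact this
  · exact (he 0).elim

/-- Moving along row `i` does not change the shape relative to a point of another row, so equality
with that point persists. -/
lemma eq_of_eq (hg : IsShapeInvariant L g) {i k : K} (hik : i ≠ k) {q : ℚ}
    (h : g (i, q) = g (k, q)) (q' : ℚ) : g (i, q') = g (i, q) := by
  let χ : L.Formula (Fin 2 × Fin m) := Formula.iInf fun l =>
    Term.equal (Term.var (0, l)) (Term.var (1, l))
  have hχ : ∀ α : Fin 2 → K × ℚ,
      χ.Realize (flatten (g ∘ α)) ↔ g (α 0) = g (α 1) := fun α => by
    simp [χ, Formula.realize_iInf, Formula.realize_equal, flatten, funext_iff]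
  have hshape : SameShape ![(i, q), (k, q)] ![(i, q'), (k, q)] := by
    constructor <;> intro x y <;> fin_cases x <;> fin_cases y <;> simp [hik, hik.symm]
  have := hg hshape χ
  rw [hχ, hχ] at this
  exact (this.1 h).trans h.symm

end IsShapeInvariant

end MutuallyIndiscernible

end KimForking

/-! ### Assembling the proposition. -/

theorem proposition3p8 {L : FirstOrder.Language.{u, v}} (T : L.Theory) (hT : T.IsComplete)
    {M : Type w} [L.Structure M] (hM : M ⊨ T)
    (μ : Cardinal.{w}) (hsat : KimForking.IsSaturated L M μ)
    {n m : ℕ} (φ : L.Formula (Fin n ⊕ Fin m)) (hφ : KimForking.HasTP2 M φ)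
    (κ : Cardinal.{w}) (hκ : ℵ₀ ≤ κ) (hκμ : κ < μ) :
    ∃ (A : Set M) (d : Fin n → M) (c : κ.ord.ToType → Fin m → M)
      (J : κ.ord.ToType → ℕ → Fin m → M),
      #A ≤ κ ∧ Function.Injective c ∧
      (∀ i, (KimForking.inst φ (c i)).Holds d) ∧
      (∀ i, KimForking.KimDividesAlong A φ (c i) (J i)) ∧
      (∀ i, ¬ KimForking.KimIndep L A d (Set.range (c i))) ∧
      (∀ i k, KimForking.SameType L ∅ (KimForking.flatten (J i)) (KimForking.flatten (J k))) ∧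
      (∀ i k, KimForking.SameType L ∅ (c i) (c k)) ∧
      (∀ i, KimForking.Indep L A (c i) {e | ∃ k, k ≠ i ∧ e ∈ Set.range (c k)}) ∧
      (∀ i, KimForking.KimIndep L A (c i) {e | ∃ k, k ≠ i ∧ e ∈ Set.range (c k)}) := by
  have hcard : #κ.ord.ToType = κ := mk_ord_toType κ
  obtain ⟨g, d, hg, hinc, hd⟩ := hφ.exists_array hsat κ.ord.ToType (hκ.trans_eq hcard.symm)
    (hcard.trans_lt hκμ)
  have hdiv : ∀ i, KimForking.KimDividesAlong (KimForking.arrayBase g) φ (g (i, 1))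
      fun t => g (i, KimForking.posColumn t) := by
    refine fun i => ⟨by simp, hg.isMorley i, fun hc => ?_⟩
    obtain ⟨x, hx⟩ := hc {KimForking.inst φ (g (i, KimForking.posColumn 0)),
      KimForking.inst φ (g (i, KimForking.posColumn 1))}
      (by rintro _ (rfl | rfl) <;> exact ⟨_, rfl⟩) (by simp)
    exact hinc i _ _ (KimForking.posColumn_lt_posColumn.2 zero_lt_one).ne
      ⟨x, hx _ (Or.inr rfl), hx _ (Or.inl rfl)⟩
  have hrow := hg.sameType_row
  have hind : ∀ i, KimForking.Indep L (KimForking.arrayBase g) (g (i, 1))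
      {e | ∃ k, k ≠ i ∧ e ∈ Set.range (g (k, 1))} := by
    refine fun i => hg.indep zero_lt_one ?_
    rintro _ ⟨k, hk, l, rfl⟩
    exact ⟨_, l, rfl, fun h => (hk h).elim⟩
  refine ⟨KimForking.arrayBase g, d, fun i => g (i, 1), fun i t => g (i, KimForking.posColumn t),
    (KimForking.mk_arrayBase_le (hκ.trans_eq hcard.symm) g).trans_eq hcard, ?_, hd, hdiv,
    fun i => KimForking.not_kimIndep_of_kimDivides ⟨_, hdiv i⟩ (hd i), hrow, ?_, hind,
    fun i => (hind i).kimIndep⟩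
  · intro i k hik
    by_contra hne
    -- Equal `c_i` and `c_k` would force columns `1` and `2` of row `i` to coincide, and `d` would
    -- satisfy two incompatible instances.
    have h2 := hg.eq_of_eq hne hik 2
    exact hinc i 2 1 (by norm_num) ⟨d, h2 ▸ hd i, hd i⟩
  · intro i k p θ e he
    have h := hrow i k p (θ.relabel (Sum.map (fun x => (0, x)) id)) e he
    rw [FirstOrder.Language.Formula.realize_relabel,
      FirstOrder.Language.Formula.realize_relabel] at h
    have hc : ∀ i, Sum.elim (KimForking.flatten fun t => g (i, KimForking.posColumn t)) e ∘
        Sum.map (fun x => (0, x)) id = Sum.elim (g (i, 1)) e := fun i => by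
      ext x
      cases x <;> simp [KimForking.flatten]
    rwa [hc, hc] at h
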